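/- A filtered simplicial complex $\mathcal K$ is an abstract simplicial complex $K$ (a set of non-empty finite sets, closed under passing to non-empty subsets) with a function $f:K\to\mathbb R$ such that $f(\sigma)\le f(\tau)$ whenever $\sigma\subseteq\tau$, and such that $\mathcal K_r=\{\sigma\in K: f(\sigma)\le r\}$ is finite for every scale $r\in\mathbb R$. Homology is simplicial homology with coefficients in $\mathbb Z/2$. The $n$-th persistence diagram $PD_n(\mathcal K)$ is the multiset of points $(b,d)$, $b\in\mathbb R$, $b<d\le\infty$, recording the $n$-dimensional classes born at scale $b$ and dying at scale $d$ ($d=\infty$ if they never die), together with every diagonal point $(x,x)$, $x\in\mathbb R$, with countably infinite multiplicity. A matching $\pi:PD_n(\mathcal K)\to PD_n(\mathcal L)$ is a bijection of these multisets, diagonal points included. Put $d_\infty((b,d),(b',d'))=\max(|b-b'|,|d-d'|)$, where $|\infty-\infty|=0$ and $|\infty-d|=\infty$ for $d<\infty$, and $$W_p(PD_n(\mathcal K),PD_n(\mathcal L))=\inf_\pi\Big(\sum_{x\in PD_n(\mathcal K)}d_\infty(x,\pi(x))^p\Big)^{1/p}\in[0,\infty].$$ **Theorem.** Let $\mathcal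 K(\cdot,t)$ and $\mathcal L(\cdot,t)$, $t\in\mathbb R$, be filtered simplicial complexes varying with time $t$, with complexes $\mathcal K(r,t)$ and $\mathcal L(r,t)$ at scale $r$, and fix a time $t^*$. Assume that the persistence diagrams of the filtered complexes $\mathcal K=\mathcal K(\cdot,t^*)$ and $\mathcal L=\mathcal L(\cdot,t^*)$ have off-diagonal points in only finitely many dimensions $n$, and only finitely many (with multiplicity) in each dimension. Let $N=\max\{\dim\mathcal K,\dim\mathcal L\}\in\{0,1,\dots,\infty\}$ be the larger of the dimensions of the underlying simplicial complexes (an empty complex counts as dimension $0$). Let $\chi(S)=\sum_{i\ge0}(-1)^i\,\#\{i\text{-simplices of }S\}$ be the Euler characteristic of a finite complex $S$, and let $\|\cdot\|_p$ be the $L^p(\mathbb R)$ norm in the variable $r$. Then, as inequalities in $[0,\infty]$ (sums run over the integers $0\le n\le N$, over all $n\ge 0$ if $N=\infty$): 1. $\displaystyle\|\chi(\mathcal K(r,t^*))-\chi(\mathcal L(r,t^*))\|_1\le 2\sum_{n=0}^N W_1(PD_n(\mathcal K),PD_n(\mathcal L))$; 2. for every choice of matchings $\pi_n:PD_n(\mathcal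 K)\to PD_n(\mathcal L)$, $n\ge0$ (in particular for matchings that are optimal for $W_1$ or for $W_2$), $$\|\chi(\mathcal K(r,t^*))-\chi(\mathcal L(r,t^*))\|_2\le\sum_{n=0}^N\ \sum_{x\in PD_n(\mathcal K)}\sqrt{2\,d_\infty(x,\pi_n(x))}.$$ -/

import Mathlib

open scoped ENNReal

noncomputable section

namespace ECS

/-! ### Simplicial homology with coefficients in `ℤ/2` -/

section Homology

variable {V : Type*}

/-- Formal sums with coefficients in `ℤ/2` of finite vertex sets; the chains of a complex are cut
out of these. -/
def Chain (V : Type*) : Type _ := Finset V →₀ ZMod 2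

instance (V : Type*) : AddCommGroup (Chain V) := inferInstanceAs (AddCommGroup (Finset V →₀ ZMod 2))

instance (V : Type*) : Module (ZMod 2) (Chain V) :=
  inferInstanceAs (Module (ZMod 2) (Finset V →₀ ZMod 2))

/-- The finite vertex sets, as a basis of the space of all formal sums. -/
def Chain.basis (V : Type*) : Module.Basis (Finset V) (ZMod 2) (Chain V) :=
  Module.Basis.ofRepr (LinearEquiv.refl (ZMod 2) (Finset V →₀ ZMod 2))

open Classical in
/-- The boundary operator, in all degrees at once. The boundary of a simplex is the sum of its
codimension-one faces; the boundary of a vertex is zero (homology is not reduced). -/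
def boundary (V : Type*) : Chain V →ₗ[ZMod 2] Chain V :=
  (Chain.basis V).constr (ZMod 2) fun s =>
    if 2 ≤ s.card then ∑ v ∈ s, Chain.basis V (s.erase v) else 0

/-- The `n`-chains of the complex `S`: combinations of its simplices with `n + 1` vertices. -/
def chains (S : PreAbstractSimplicialComplex V) (n : ℕ) : Submodule (ZMod 2) (Chain V) :=
  Submodule.span (ZMod 2) (Chain.basis V '' {s | s ∈ S ∧ s.card = n + 1})

/-- The `n`-cycles of `S`. -/
def cycles (S : PreAbstractSimplicialComplex V) (n : ℕ) : Submodule (ZMod 2) (Chain V) :=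
  chains S n ⊓ LinearMap.ker (boundary V)

/-- The `n`-boundaries of `S`. -/
def boundaries (S : PreAbstractSimplicialComplex V) (n : ℕ) : Submodule (ZMod 2) (Chain V) :=
  (chains S (n + 1)).map (boundary V)

/-- The `n`-th simplicial homology `H_n(S; ℤ/2)`, cycles modulo boundaries. -/
abbrev Homology (S : PreAbstractSimplicialComplex V) (n : ℕ) : Type _ :=
  cycles S n ⧸ (boundaries S n).submoduleOf (cycles S n)

theorem chains_mono {S T : PreAbstractSimplicialComplex V} (h : S ≤ T) (n : ℕ) :
    chains S n ≤ chains T n :=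
  Submodule.span_mono (Set.image_mono fun _ hs => ⟨h hs.1, hs.2⟩)

theorem cycles_mono {S T : PreAbstractSimplicialComplex V} (h : S ≤ T) (n : ℕ) :
    cycles S n ≤ cycles T n :=
  inf_le_inf_right _ (chains_mono h n)

theorem boundaries_mono {S T : PreAbstractSimplicialComplex V} (h : S ≤ T) (n : ℕ) :
    boundaries S n ≤ boundaries T n :=
  Submodule.map_mono (chains_mono h (n + 1))

/-- The map `H_n(S) → H_n(T)` induced by the inclusion of a subcomplex `S ≤ T`. -/
def homologyMap {S T : PreAbstractSimplicialComplex V} (h : S ≤ T) (n : ℕ) :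
    Homology S n →ₗ[ZMod 2] Homology T n :=
  Submodule.mapQ _ _ (Submodule.inclusion (cycles_mono h n)) fun _ hx => boundaries_mono h n hx

/-- The persistent Betti number: the rank of `H_n(S) → H_n(T)`. -/
def persistentBetti {S T : PreAbstractSimplicialComplex V} (h : S ≤ T) (n : ℕ) : ℕ :=
  Module.finrank (ZMod 2) (LinearMap.range (homologyMap h n))

/-- The Euler characteristic `∑ₙ (-1)ⁿ #{n-simplices}` (of a finite complex). -/
def eulerChar (S : PreAbstractSimplicialComplex V) : ℤ :=
  ∑ᶠ n : ℕ, (-1) ^ n * (Set.ncard {s | s ∈ S ∧ s.card = n + 1} : ℤ)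

/-- The dimension of a simplicial complex (by convention `0` for the empty complex). -/
def dim (S : PreAbstractSimplicialComplex V) : ℕ∞ :=
  ⨆ s ∈ S, ((s.card - 1 : ℕ) : ℕ∞)

end Homology

/-! ### Filtered complexes and their persistence diagrams -/

/-- A filtered simplicial complex: a simplicial complex with a monotone filtration function all of
whose sublevel complexes are finite. (The values of `scale` off the complex are irrelevant.) -/
structure FilteredComplex (V : Type*) where
  complex : PreAbstractSimplicialComplex V
  scale : Finset V → ℝ
  scale_mono : ∀ s ∈ complex, ∀ t ∈ complex, s ⊆ t → scale s ≤ scale t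
  finite_sublevel : ∀ r : ℝ, {s | s ∈ complex ∧ scale s ≤ r}.Finite

namespace FilteredComplex

variable {V : Type*} (K : FilteredComplex V)

/-- The subcomplex of the simplices whose scale lies in a lower set of reals. With
`LowerSet.Iic r` this is `K_r`, with `LowerSet.Iio r` the union of the `K_q` with `q < r`,
and with `⊤` the whole complex. -/
def sub (U : LowerSet ℝ) : PreAbstractSimplicialComplex V where
  faces := {s | s ∈ K.complex ∧ K.scale s ∈ U}
  isRelLowerSet_faces := by
    rintro s ⟨hs, hU⟩
    have h := K.complex.isRelLowerSet_faces hs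
    exact ⟨h.1, fun t hts ht =>
      ⟨h.2 hts ht, U.lower (K.scale_mono t (h.2 hts ht) s hs hts) hU⟩⟩

theorem sub_mono {U U' : LowerSet ℝ} (h : U ≤ U') : K.sub U ≤ K.sub U' :=
  fun _ hs => ⟨hs.1, h hs.2⟩

/-- The complex `K_r` at scale `r`. -/
def atScale (r : ℝ) : PreAbstractSimplicialComplex V := K.sub (LowerSet.Iic r)

/-- The rank of `H_n(K_U) → H_n(K_{U'})` for lower sets `U ≤ U'` of scales. -/
def rank (n : ℕ) {U U' : LowerSet ℝ} (h : U ≤ U') : ℕ :=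
  persistentBetti (K.sub_mono h) n

theorem Iio_le_Iic (b : ℝ) : LowerSet.Iio b ≤ LowerSet.Iic b :=
  fun _ hx => le_of_lt (LowerSet.mem_Iio_iff.1 hx)

theorem Iic_le_Iio {b d : ℝ} (h : b < d) : LowerSet.Iic b ≤ LowerSet.Iio d :=
  fun _ hx => LowerSet.mem_Iio_iff.2 (lt_of_le_of_lt (LowerSet.mem_Iic_iff.1 hx) h)

/-- The multiplicity of the off-diagonal point `(b, d)` in the `n`-th persistence diagram: the
number of independent classes born exactly at scale `b` that die exactly at scale `d` (that never
die, if `d = ∞`). With `β` the ranks of the maps induced by inclusion, it is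
`(β(b, d⁻) - β(b⁻, d⁻)) - (β(b, d) - β(b⁻, d))` for `b < d < ∞` and `β(b, ∞) - β(b⁻, ∞)` for
`d = ∞`, where `b⁻` means "just before `b`". -/
def multiplicity (n : ℕ) (b : ℝ) : WithTop ℝ → ℕ
  | (d : ℝ) =>
    if h : b < d then
      (((K.rank n (Iic_le_Iio h) : ℤ)
          - K.rank n ((Iio_le_Iic b).trans (Iic_le_Iio h)))
        - ((K.rank n ((Iic_le_Iio h).trans (Iio_le_Iic d)) : ℤ)
          - K.rank n ((Iio_le_Iic b).trans ((Iic_le_Iio h).trans (Iio_le_Iic d))))).toNat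
    else 0
  | ⊤ =>
    ((K.rank n (le_top : LowerSet.Iic b ≤ ⊤) : ℤ)
      - K.rank n (le_top : LowerSet.Iio b ≤ ⊤)).toNat

/-- The off-diagonal points of the `n`-th persistence diagram, listed with multiplicity. -/
def Point (n : ℕ) : Type := Σ p : ℝ × WithTop ℝ, Fin (K.multiplicity n p.1 p.2)

/-- The `n`-th persistence diagram, as an indexed family: its off-diagonal points, together with
every diagonal point `(x, x)` with countably infinite multiplicity. -/
def Diagram (n : ℕ) : Type := K.Point n ⊕ (ℝ × ℕ)

/-- The location `(birth, death)` of a point of the persistence diagram. -/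
def Diagram.loc {K : FilteredComplex V} {n : ℕ} : K.Diagram n → ℝ × WithTop ℝ
  | Sum.inl p => p.1
  | Sum.inr q => (q.1, (q.1 : WithTop ℝ))

end FilteredComplex

/-! ### Wasserstein distances -/

/-- The distance of two extended reals in `(-∞, ∞]`, with `|∞ - ∞| = 0`. -/
def deathDist : WithTop ℝ → WithTop ℝ → ℝ≥0∞
  | (x : ℝ), (y : ℝ) => edist x y
  | ⊤, ⊤ => 0
  | (_ : ℝ), ⊤ => ⊤
  | ⊤, (_ : ℝ) => ⊤

/-- The `d_∞` distance of two points of the extended plane. -/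
def distInf (x y : ℝ × WithTop ℝ) : ℝ≥0∞ :=
  max (edist x.1 y.1) (deathDist x.2 y.2)

section Wasserstein

variable {V W : Type*}

/-- A matching of two persistence diagrams: a bijection, diagonal points included. -/
abbrev Matching (K : FilteredComplex V) (L : FilteredComplex W) (n : ℕ) : Type :=
  K.Diagram n ≃ L.Diagram n

/-- The `p`-Wasserstein distance of the `n`-th persistence diagrams of `K` and `L`. -/
def wasserstein (p : ℝ) (K : FilteredComplex V) (L : FilteredComplex W) (n : ℕ) : ℝ≥0∞ :=
  ⨅ π : Matching K L n, (∑' x : K.Diagram n, distInf x.loc (π x).loc ^ p) ^ (1 / p)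

end Wasserstein

/-! ### Euler characteristic surfaces -/

/-- The Euler characteristic surface `(r, t) ↦ χ(K(r, t))` of a filtered simplicial complex that
varies with the time `t`. -/
def eulerSurface {V : Type*} (K : ℝ → FilteredComplex V) (r t : ℝ) : ℤ :=
  eulerChar ((K t).atScale r)

end ECS

end

noncomputable section

namespace ECS

open MeasureTheory

/-! ### Linear algebra of chains -/

section LinearAlgebra

/-! By Euler–Poincaré, χ(K_r) is the alternating sum of the Betti numbers of K_r, and the n-th Betti
number counts the diagram points with b ≤ r < d (`card_lifetime`). So each Betti curve is a sum of
indicators of lifetimes [b, d). Diagonal points have empty lifetime and may be added freely, so a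
matching writes the difference of two Betti curves as a sum of differences of paired indicators. The
L^q norm of such a difference is |A ∆ B|^(1/q), and |A ∆ B| ≤ |b - b'| + |d - d'| ≤ 2 d_∞
(`volume_symmDiff_lifetime_le`). Minkowski's inequality over points and dimensions gives both
bounds, with q = 1 and q = 2.

The counting step rests on multiplicities being mixed second differences of dim (Z_n(K_U) ∩
B_n(K_U')). Supermodularity makes these nonnegative, and they telescope over births and deaths. -/

theorem finrank_map_add_finrank_inf_ker {k E F : Type*} [Field k] [AddCommGroup E] [Module k E]
    [AddCommGroup F] [Module k F] (f : E →ₗ[k] F) (p : Submodule k E) [FiniteDimensional k p] :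
    Module.finrank k (p.map f) + Module.finrank k (p ⊓ LinearMap.ker f : Submodule k E)
      = Module.finrank k p := by
  have h := (f.domRestrict p).finrank_range_add_finrank_ker
  rwa [LinearMap.range_domRestrict, LinearMap.ker_domRestrict,
    ← Submodule.finrank_map_subtype_eq, Submodule.map_comap_subtype] at h

/-- The dimension of the intersection of an increasing pair of subspaces with another increasing
pair is supermodular. -/
theorem finrank_inf_supermodular {k E : Type*} [Field k] [AddCommGroup E] [Module k E]
    {Z Z' B B' : Submodule k E} [FiniteDimensional k Z'] (hZ : Z ≤ Z') (hB : B ≤ B') :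
    Module.finrank k (Z' ⊓ B : Submodule k E) + Module.finrank k (Z ⊓ B' : Submodule k E)
      ≤ Module.finrank k (Z' ⊓ B' : Submodule k E) + Module.finrank k (Z ⊓ B : Submodule k E) := by
  have : FiniteDimensional k Z := Submodule.finiteDimensional_of_le hZ
  rw [← Submodule.finrank_sup_add_finrank_inf_eq]
  -- The two spaces on the left meet in Z ⊓ B and their sum lies in Z' ⊓ B'.
  have h1 : (Z' ⊓ B) ⊓ (Z ⊓ B') = Z ⊓ B :=
    le_antisymm (le_inf (inf_le_right.trans inf_le_left) (inf_le_left.trans inf_le_right))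
      (le_inf (inf_le_inf_right _ hZ) (inf_le_inf_left _ hB))
  rw [h1]
  gcongr
  exact Submodule.finrank_mono (sup_le (inf_le_inf_left _ hB) (inf_le_inf_right _ hZ))

end LinearAlgebra

/-! ### Boundary operator, Euler–Poincaré formula, ranks of induced maps. -/

section Homology

variable {V : Type*} {S T : PreAbstractSimplicialComplex V} {n : ℕ}

theorem boundary_basis_of_card_lt {s : Finset V} (hs : s.card < 2) :
    boundary V (Chain.basis V s) = 0 := by
  rw [boundary, Module.Basis.constr_basis, if_neg (by omega)]

open Classical in
theorem boundary_basis_of_le_card {s : Finset V} (hs : 2 ≤ s.card) :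
    boundary V (Chain.basis V s) = ∑ v ∈ s, Chain.basis V (s.erase v) := by
  rw [boundary, Module.Basis.constr_basis, if_pos hs]

-- Each face obtained by deleting two vertices appears once per order of deletion, and the two
-- copies cancel mod 2.
open Classical in
theorem boundary_boundary (x : Chain V) : boundary V (boundary V x) = 0 := by
  suffices h : boundary V ∘ₗ boundary V = 0 from LinearMap.congr_fun h x
  refine (Chain.basis V).ext fun s => ?_
  rw [LinearMap.comp_apply, LinearMap.zero_apply]
  rcases lt_or_ge s.card 2 with hs | hs
  · rw [boundary_basis_of_card_lt hs, map_zero]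
  rw [boundary_basis_of_le_card hs, map_sum]
  -- An edge is separate: its faces are vertices, whose boundary is zero by convention rather than
  -- the empty face.
  rcases hs.eq_or_lt with hs2 | hs3
  · exact Finset.sum_eq_zero fun v hv =>
      boundary_basis_of_card_lt (by rw [Finset.card_erase_of_mem hv]; omega)
  rw [Finset.sum_congr rfl fun v hv =>
    boundary_basis_of_le_card (by rw [Finset.card_erase_of_mem hv]; omega), Finset.sum_sigma']
  refine Finset.sum_involution (fun a _ => ⟨a.2, a.1⟩) ?_ ?_ ?_ ?_
  · rintro ⟨v, w⟩ -
    simp only [Finset.erase_right_comm (a := w)]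
    exact ZModModule.add_self _
  · rintro ⟨v, w⟩ h - h'
    simp only [Sigma.mk.injEq, heq_eq_eq] at h'
    simp [h'.1] at h
  · rintro ⟨v, w⟩ h
    simp only [Finset.mem_sigma, Finset.mem_erase] at h ⊢
    exact ⟨h.2.2, fun e => h.2.1 e.symm, h.1⟩
  · rintro ⟨v, w⟩ -
    rfl

theorem map_boundary_chains_succ_le : (chains S (n + 1)).map (boundary V) ≤ chains S n := by
  classical
  rw [chains, Submodule.map_span, Submodule.span_le]
  rintro _ ⟨_, ⟨s, ⟨hs, hc⟩, rfl⟩, rfl⟩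
  rw [boundary_basis_of_le_card (by omega)]
  refine Submodule.sum_mem _ fun v hv => Submodule.subset_span ⟨s.erase v, ⟨?_, ?_⟩, rfl⟩
  · refine (S.isRelLowerSet_faces hs).2 (Finset.erase_subset v s) ?_
    rw [← Finset.card_pos, Finset.card_erase_of_mem hv]
    omega
  · rw [Finset.card_erase_of_mem hv]
    omega

theorem boundaries_le_cycles : boundaries S n ≤ cycles S n := by
  refine le_inf map_boundary_chains_succ_le ?_
  rintro _ ⟨x, -, rfl⟩
  exact boundary_boundary x

theorem cycles_zero : cycles S 0 = chains S 0 := by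
  refine inf_eq_left.2 (Submodule.span_le.2 ?_)
  rintro _ ⟨s, ⟨-, hc⟩, rfl⟩
  exact boundary_basis_of_card_lt (by omega)

theorem finiteDimensional_chains (hS : {s | s ∈ S}.Finite) (n : ℕ) :
    FiniteDimensional (ZMod 2) (chains S n) :=
  FiniteDimensional.span_of_finite _ ((hS.subset fun _ hs => hs.1).image _)

theorem finiteDimensional_cycles (hS : {s | s ∈ S}.Finite) (n : ℕ) :
    FiniteDimensional (ZMod 2) (cycles S n) :=
  have := finiteDimensional_chains hS n
  Submodule.finiteDimensional_of_le (inf_le_left : cycles S n ≤ chains S n)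

theorem finrank_chains (hS : {s | s ∈ S}.Finite) (n : ℕ) :
    Module.finrank (ZMod 2) (chains S n) = Set.ncard {s | s ∈ S ∧ s.card = n + 1} := by
  have hf : (Chain.basis V '' {s | s ∈ S ∧ s.card = n + 1}).Finite :=
    (hS.subset fun _ hs => hs.1).image _
  have := hf.fintype
  rw [chains, finrank_span_set_eq_card, ← Set.ncard_eq_toFinset_card',
    Set.ncard_image_of_injective _ (Chain.basis V).injective]
  exact ((Chain.basis V).linearIndependent.linearIndepOn_id).mono (Set.image_subset_range _ _)

theorem chains_eq_bot (h : ∀ s ∈ S, s.card ≠ n + 1) : chains S n = ⊥ := by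
  rw [chains, Submodule.span_eq_bot]
  rintro _ ⟨s, hs, -⟩
  exact absurd hs.2 (h s hs.1)

theorem finrank_boundaries_add_finrank_cycles (hS : {s | s ∈ S}.Finite) (n : ℕ) :
    Module.finrank (ZMod 2) (boundaries S n) + Module.finrank (ZMod 2) (cycles S (n + 1))
      = Module.finrank (ZMod 2) (chains S (n + 1)) :=
  have := finiteDimensional_chains hS (n + 1)
  finrank_map_add_finrank_inf_ker (boundary V) (chains S (n + 1))

/-- Substituting dim C_{n+1} = dim B_n + dim Z_{n+1} shifts the boundary terms by one degree;
truncation leaves B_m uncancelled. -/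
theorem sum_neg_one_pow_mul_finrank_chains (hS : {s | s ∈ S}.Finite) (m : ℕ) :
    ∑ n ∈ Finset.range (m + 1), (-1 : ℤ) ^ n * (Module.finrank (ZMod 2) (chains S n) : ℤ)
      = ∑ n ∈ Finset.range (m + 1), (-1 : ℤ) ^ n *
          ((Module.finrank (ZMod 2) (cycles S n) : ℤ) - Module.finrank (ZMod 2) (boundaries S n))
        + (-1) ^ m * Module.finrank (ZMod 2) (boundaries S m) := by
  induction m with
  | zero =>
    rw [zero_add, Finset.sum_range_one, Finset.sum_range_one, cycles_zero]
    ring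
  | succ m ih =>
    rw [Finset.sum_range_succ, ih, Finset.sum_range_succ _ (m + 1),
      ← finrank_boundaries_add_finrank_cycles hS m]
    push_cast
    ring

/-- The Euler–Poincaré formula. -/
theorem eulerChar_eq_finsum (hS : {s | s ∈ S}.Finite) :
    eulerChar S = ∑ᶠ n : ℕ, (-1 : ℤ) ^ n *
      ((Module.finrank (ZMod 2) (cycles S n) : ℤ) - Module.finrank (ZMod 2) (boundaries S n)) := by
  obtain ⟨m, hm⟩ : ∃ m, ∀ s ∈ S, s.card < m := by
    obtain ⟨m, hm⟩ := (hS.image Finset.card).bddAbove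
    exact ⟨m + 1, fun s hs => Nat.lt_succ_of_le (hm ⟨s, hs, rfl⟩)⟩
  have hbot : ∀ n, m ≤ n → chains S n = ⊥ := fun n hn =>
    chains_eq_bot fun s hs h => by have := hm s hs; omega
  have hcyc : ∀ n, m ≤ n → cycles S n = ⊥ := fun n hn => by rw [cycles, hbot n hn, bot_inf_eq]
  have hbd : ∀ n, m ≤ n → boundaries S n = ⊥ := fun n hn =>
    le_bot_iff.1 (boundaries_le_cycles.trans_eq (hcyc n hn))
  have hsub : ∀ f : ℕ → ℤ, (∀ n, m ≤ n → f n = 0) →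
      ∑ᶠ n, f n = ∑ n ∈ Finset.range (m + 1), f n := fun f hf => by
    refine finsum_eq_sum_of_support_subset _ fun n hn => ?_
    by_contra h
    exact hn (hf n (by simp only [Finset.coe_range, Set.mem_Iio] at h; omega))
  simp only [eulerChar, ← finrank_chains hS]
  rw [hsub _ fun n hn => by rw [hbot n hn, finrank_bot, Nat.cast_zero, mul_zero],
    hsub _ fun n hn => by rw [hcyc n hn, hbd n hn, sub_self, mul_zero],
    sum_neg_one_pow_mul_finrank_chains hS, hbd m le_rfl, finrank_bot, Nat.cast_zero, mul_zero,
    add_zero]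

/-- The rank of the map in homology in terms of cycles and boundaries. -/
theorem persistentBetti_add_finrank (h : S ≤ T) (hS : {s | s ∈ S}.Finite) (n : ℕ) :
    persistentBetti h n + Module.finrank (ZMod 2) (cycles S n ⊓ boundaries T n : Submodule _ _)
      = Module.finrank (ZMod 2) (cycles S n) := by
  have := finiteDimensional_cycles hS n
  have hcomp : homologyMap h n ∘ₗ Submodule.mkQ _
      = Submodule.mkQ ((boundaries T n).submoduleOf (cycles T n)) ∘ₗ
          Submodule.inclusion (cycles_mono h n) := Submodule.mapQ_mkQ _ _ _
  -- Precomposing with the surjection from cycles keeps the range, and the kernel becomes the cycles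
  -- of S that bound in T; rank–nullity then applies.
  have hr : LinearMap.range (homologyMap h n)
      = LinearMap.range (homologyMap h n ∘ₗ Submodule.mkQ _) := by
    rw [LinearMap.range_comp, Submodule.range_mkQ, Submodule.map_top]
  have hk : LinearMap.ker (homologyMap h n ∘ₗ Submodule.mkQ _)
      = (boundaries T n).comap (cycles S n).subtype := by
    rw [hcomp, LinearMap.ker_comp, Submodule.ker_mkQ]
    rfl
  rw [persistentBetti, hr, ← Submodule.map_comap_subtype, Submodule.finrank_map_subtype_eq, ← hk]
  exact LinearMap.finrank_range_add_finrank_ker _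

end Homology

/-! ### Betti numbers as numbers of points of the persistence diagram -/

/-- A function of lower sets of reals that changes only at the points of `C` is the sum of its
jumps. -/
theorem sum_jumps {F : LowerSet ℝ → ℤ} {C : Set ℝ}
    (hF : ∀ U U', U ≤ U' → (∀ c ∈ C, c ∈ U' → c ∈ U) → F U = F U')
    {c : Finset ℝ} {U U' : LowerSet ℝ} (hU : U ≤ U')
    (hc : ∀ x, x ∈ c ↔ x ∈ C ∧ x ∈ U' ∧ x ∉ U) :
    ∑ d ∈ c, (F (LowerSet.Iic d) - F (LowerSet.Iio d)) = F U' - F U := by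
  classical
  -- The largest jump m splits the path to U' into a part below m, the jump at m, and a part above m
  -- where F is constant.
  induction c using Finset.induction_on_max generalizing U' with
  | empty =>
    rw [Finset.sum_empty, hF U U' hU fun x hx hx' => by_contra fun h =>
      Finset.notMem_empty x ((hc x).2 ⟨hx, hx', h⟩), sub_self]
  | insert m s hm ih =>
    obtain ⟨hmC, hmU', hmU⟩ := (hc m).1 (Finset.mem_insert_self m s)
    have hms : m ∉ s := fun h => lt_irrefl _ (hm m h)
    have hUm : ∀ x ∈ U, x < m := fun x hx => lt_of_not_ge fun h => hmU (U.lower h hx)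
    rw [Finset.sum_insert hms, ih (U' := LowerSet.Iio m) (fun x hx => hUm x hx) fun x => ?_,
      hF (LowerSet.Iic m) U' (LowerSet.Iic_le.2 hmU') fun x hx hx' => ?_]
    · ring
    · by_cases hxU : x ∈ U
      · exact (hUm x hxU).le
      · rcases Finset.mem_insert.1 ((hc x).2 ⟨hx, hx', hxU⟩) with rfl | h
        · exact LowerSet.mem_Iic_iff.2 le_rfl
        · exact (hm x h).le
    · rw [LowerSet.mem_Iio_iff]
      constructor
      · intro hx
        have := (hc x).1 (Finset.mem_insert_of_mem hx)
        exact ⟨this.1, hm x hx, this.2.2⟩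
      · rintro ⟨hx, hxm, hxU⟩
        exact Finset.mem_of_mem_insert_of_ne
          ((hc x).2 ⟨hx, U'.lower hxm.le hmU', hxU⟩) hxm.ne

/-- The scales `r` with `b ≤ r < d` for a point `p = (b, d)`. -/
def lifetime (p : ℝ × WithTop ℝ) : Set ℝ := {r | p.1 ≤ r ∧ (r : WithTop ℝ) < p.2}

namespace FilteredComplex

variable {V : Type*} (K : FilteredComplex V) (n : ℕ)

/-- The dimension of the space of `n`-cycles of `K_U`. -/
def cycleRank (U : LowerSet ℝ) : ℕ := Module.finrank (ZMod 2) (cycles (K.sub U) n)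

/-- The dimension of the space of `n`-cycles of `K_U` that bound in `K_{U'}`. -/
def boundingRank (U U' : LowerSet ℝ) : ℕ :=
  Module.finrank (ZMod 2) (cycles (K.sub U) n ⊓ boundaries (K.sub U') n : Submodule _ _)

/-- The scales of the simplices. -/
def criticalValues : Set ℝ := K.scale '' {s | s ∈ K.complex}

theorem sub_eq_sub {U U' : LowerSet ℝ} (h : U ≤ U')
    (hc : ∀ c ∈ K.criticalValues, c ∈ U' → c ∈ U) : K.sub U = K.sub U' :=
  le_antisymm (K.sub_mono h) fun s hs => ⟨hs.1, hc _ ⟨s, hs.1, rfl⟩ hs.2⟩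

theorem sub_Iio_eq {b : ℝ} (hb : b ∉ K.criticalValues) :
    K.sub (LowerSet.Iio b) = K.sub (LowerSet.Iic b) :=
  K.sub_eq_sub (Iio_le_Iic b) fun _ hc hcb =>
    lt_of_le_of_ne (LowerSet.mem_Iic_iff.1 hcb) fun h => hb (h ▸ hc)

theorem finite_criticalValues (r : ℝ) : {c ∈ K.criticalValues | c ≤ r}.Finite := by
  refine ((K.finite_sublevel r).image K.scale).subset ?_
  rintro _ ⟨⟨s, hs, rfl⟩, hr⟩
  exact ⟨s, ⟨hs, hr⟩, rfl⟩

variable {K n}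

theorem finite_sub {U : LowerSet ℝ} {r : ℝ} (hU : U ≤ LowerSet.Iic r) :
    {s | s ∈ K.sub U}.Finite :=
  (K.finite_sublevel r).subset fun _ hs => ⟨hs.1, hU hs.2⟩

/-- The bound on `U` makes the source complex finite; `U'` may be all of ℝ. -/
theorem rank_eq {U U' : LowerSet ℝ} {r : ℝ} (hU : U ≤ LowerSet.Iic r) (h : U ≤ U') :
    (K.rank n h : ℤ) = K.cycleRank n U - K.boundingRank n U U' := by
  have := persistentBetti_add_finrank (K.sub_mono h) (finite_sub hU) n
  rw [rank, cycleRank, boundingRank]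
  omega

/-- The cycle ranks cancel in the double difference, and supermodularity shows that `toNat`
truncates nothing. -/
theorem multiplicity_coe {b d : ℝ} (h : b < d) : (K.multiplicity n b d : ℤ) =
    ((K.boundingRank n (LowerSet.Iic b) (LowerSet.Iic d) : ℤ)
      - K.boundingRank n (LowerSet.Iic b) (LowerSet.Iio d))
    - (K.boundingRank n (LowerSet.Iio b) (LowerSet.Iic d)
      - K.boundingRank n (LowerSet.Iio b) (LowerSet.Iio d)) := by
  have := finiteDimensional_cycles (finite_sub (K := K) (le_refl (LowerSet.Iic b))) n
  have hmod := finrank_inf_supermodular (cycles_mono (K.sub_mono (Iio_le_Iic b)) n)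
    (boundaries_mono (K.sub_mono (Iio_le_Iic d)) n)
  change K.boundingRank n (LowerSet.Iic b) (LowerSet.Iio d)
      + K.boundingRank n (LowerSet.Iio b) (LowerSet.Iic d)
    ≤ K.boundingRank n (LowerSet.Iic b) (LowerSet.Iic d)
      + K.boundingRank n (LowerSet.Iio b) (LowerSet.Iio d) at hmod
  simp only [multiplicity, dif_pos h]
  rw [rank_eq le_rfl, rank_eq (Iio_le_Iic b), rank_eq le_rfl, rank_eq (Iio_le_Iic b)]
  omega

theorem multiplicity_top (b : ℝ) : (K.multiplicity n b ⊤ : ℤ) =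
    ((K.cycleRank n (LowerSet.Iic b) : ℤ) - K.boundingRank n (LowerSet.Iic b) ⊤)
    - (K.cycleRank n (LowerSet.Iio b) - K.boundingRank n (LowerSet.Iio b) ⊤) := by
  have := finiteDimensional_cycles (finite_sub (K := K) (le_refl (LowerSet.Iic b))) n
  -- With the space of all chains as the larger second space, its intersections with the cycle
  -- spaces are the cycle spaces themselves.
  have hmod := finrank_inf_supermodular (cycles_mono (K.sub_mono (Iio_le_Iic b)) n)
    (le_top : boundaries (K.sub ⊤) n ≤ ⊤)
  rw [inf_top_eq, inf_top_eq] at hmod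
  change K.boundingRank n (LowerSet.Iic b) ⊤ + K.cycleRank n (LowerSet.Iio b)
    ≤ K.cycleRank n (LowerSet.Iic b) + K.boundingRank n (LowerSet.Iio b) ⊤ at hmod
  simp only [multiplicity]
  rw [rank_eq le_rfl, rank_eq (Iio_le_Iic b)]
  omega

theorem multiplicity_coe_of_le {b d : ℝ} (h : d ≤ b) : K.multiplicity n b d = 0 := by
  simp only [multiplicity, dif_neg h.not_gt]

/-- If no simplex enters at b, the complexes before and at b agree and the difference in b vanishes.
This confines the births up to any scale to a finite set. -/
theorem birth_mem_criticalValues {b : ℝ} {d : WithTop ℝ} (h : K.multiplicity n b d ≠ 0) :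
    b ∈ K.criticalValues := by
  by_contra hb
  have hsub := K.sub_Iio_eq hb
  refine h (Nat.cast_injective (R := ℤ) ?_)
  induction d using WithTop.recTopCoe with
  | top => rw [multiplicity_top, cycleRank, boundingRank, ← hsub]; simp [cycleRank, boundingRank]
  | coe d =>
    rcases lt_or_ge b d with hd | hd
    · rw [multiplicity_coe hd]
      simp only [boundingRank]
      rw [← hsub]
      simp
    · rw [multiplicity_coe_of_le hd]

theorem death_mem_criticalValues {b d : ℝ} (h : K.multiplicity n b d ≠ 0) :
    d ∈ K.criticalValues := by
  by_contra hd
  refine h (Nat.cast_injective (R := ℤ) ?_)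
  rcases lt_or_ge b d with hbd | hbd
  · rw [multiplicity_coe hbd]
    simp only [boundingRank]
    rw [← K.sub_Iio_eq hd]
    simp
  · rw [multiplicity_coe_of_le hbd]

theorem multiplicity_eq_zero_of_chains_eq_bot (h : ∀ s ∈ K.complex, s.card ≠ n + 1) (b : ℝ)
    (d : WithTop ℝ) : K.multiplicity n b d = 0 := by
  have hz : ∀ U, cycles (K.sub U) n = ⊥ := fun U => by
    rw [cycles, chains_eq_bot fun s (hs : s ∈ K.sub U) => h s hs.1, bot_inf_eq]
  have hz1 : ∀ U, K.cycleRank n U = 0 := fun U => by rw [cycleRank, hz, finrank_bot]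
  have hw : ∀ U U', K.boundingRank n U U' = 0 := fun U U' => by
    rw [boundingRank, hz, bot_inf_eq, finrank_bot]
  refine Nat.cast_injective (R := ℤ) ?_
  induction d using WithTop.recTopCoe with
  | top => rw [multiplicity_top]; simp [hz1, hw]
  | coe d =>
    rcases lt_or_ge b d with hd | hd
    · rw [multiplicity_coe hd]; simp [hw]
    · rw [multiplicity_coe_of_le hd]

/-- Ensures that restricting the sums to n ≤ N loses no diagram point. -/
theorem le_dim_of_nonempty_point (h : Nonempty (K.Point n)) : (n : ℕ∞) ≤ dim K.complex := by
  obtain ⟨⟨b, d⟩, i⟩ := h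
  by_contra hn
  refine (Fin.pos i).ne' (multiplicity_eq_zero_of_chains_eq_bot (fun s hs hc => hn ?_) b d)
  refine le_trans ?_ (le_iSup₂ (f := fun s (_ : s ∈ K.complex) => ((s.card - 1 : ℕ) : ℕ∞)) s hs)
  simp [hc]

/-- The cycles of `K_r` that bound at all do so at a common finite scale. -/
theorem exists_forall_boundingRank_eq (K : FilteredComplex V) (n : ℕ) (r : ℝ) :
    ∃ R, r ≤ R ∧ ∀ U U', U ≤ LowerSet.Iic r → LowerSet.Iic R ≤ U' →
      K.boundingRank n U U' = K.boundingRank n U ⊤ := by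
  have hfin := finiteDimensional_cycles (finite_sub (K := K) (le_refl (LowerSet.Iic r))) n
  -- Over ℤ/2 the finite-dimensional cycle space is a finite set, so a bounding scale chosen for
  -- each cycle separately has a common upper bound.
  have hZ : Finite (cycles (K.sub (LowerSet.Iic r)) n) := Module.finite_of_finite (ZMod 2)
  have hchains : ∀ y ∈ chains (K.sub ⊤) (n + 1), ∃ R,
      y ∈ chains (K.sub (LowerSet.Iic R)) (n + 1) := by
    intro y hy
    refine Submodule.span_induction ?_ ⟨0, Submodule.zero_mem _⟩ ?_ ?_ hy
    · rintro _ ⟨s, hs, rfl⟩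
      exact ⟨K.scale s, Submodule.subset_span ⟨s, ⟨⟨hs.1.1, le_refl (K.scale s)⟩, hs.2⟩, rfl⟩⟩
    · rintro x y - - ⟨R, hR⟩ ⟨R', hR'⟩
      exact ⟨max R R', Submodule.add_mem _
        (chains_mono (K.sub_mono (LowerSet.Iic_le.2 (le_max_left R R'))) _ hR)
        (chains_mono (K.sub_mono (LowerSet.Iic_le.2 (le_max_right R R'))) _ hR')⟩
    · rintro a x - ⟨R, hR⟩
      exact ⟨R, Submodule.smul_mem _ a hR⟩
  have hx : ∀ x : cycles (K.sub (LowerSet.Iic r)) n, ∃ R, (x : Chain V) ∈ boundaries (K.sub ⊤) n →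
      (x : Chain V) ∈ boundaries (K.sub (LowerSet.Iic R)) n := by
    intro x
    by_cases h : (x : Chain V) ∈ boundaries (K.sub ⊤) n
    · obtain ⟨y, hy, hyx⟩ := h
      obtain ⟨R, hR⟩ := hchains y hy
      exact ⟨R, fun _ => ⟨y, hR, hyx⟩⟩
    · exact ⟨0, fun h' => absurd h' h⟩
  choose ρ hρ using hx
  obtain ⟨M, hM⟩ := (Set.finite_range ρ).bddAbove
  refine ⟨max r M, le_max_left r M, fun U U' hU hU' => ?_⟩
  rw [boundingRank, boundingRank]
  suffices h : cycles (K.sub U) n ⊓ boundaries (K.sub U') n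
      = cycles (K.sub U) n ⊓ boundaries (K.sub ⊤) n by rw [h]
  refine le_antisymm (inf_le_inf_left _ (boundaries_mono (K.sub_mono le_top) n)) ?_
  rintro x ⟨hxZ, hxB⟩
  refine ⟨hxZ, boundaries_mono (K.sub_mono (le_trans ?_ hU')) n
    (hρ ⟨x, cycles_mono (K.sub_mono hU) n hxZ⟩ hxB)⟩
  exact LowerSet.Iic_le.2 ((hM ⟨_, rfl⟩).trans (le_max_right r M))

theorem card_point_mem (s : Finset (ℝ × WithTop ℝ)) :
    Nat.card {x : K.Point n // x.1 ∈ s} = ∑ p ∈ s, K.multiplicity n p.1 p.2 := by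
  let e : {x : K.Point n // x.1 ∈ s} ≃ Σ p : s, Fin (K.multiplicity n p.1.1 p.1.2) :=
    { toFun := fun x => ⟨⟨x.1.1, x.2⟩, x.1.2⟩
      invFun := fun y => ⟨⟨y.1.1, y.2⟩, y.1.2⟩
      left_inv := fun _ => rfl
      right_inv := fun _ => rfl }
  rw [Nat.card_congr e, Nat.card_sigma]
  simp only [Nat.card_fin]
  exact Finset.sum_coe_sort s fun p => K.multiplicity n p.1 p.2

/-- Summing multiplicities over deaths after r, then over births up to r, telescopes to dim Z_n(K_r)
minus the dimension of the cycles bounding in K_r. -/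
theorem card_lifetime (K : FilteredComplex V) (n : ℕ) (r : ℝ) :
    (Nat.card {x : K.Point n // r ∈ lifetime x.1} : ℤ)
      = K.cycleRank n (LowerSet.Iic r)
        - K.boundingRank n (LowerSet.Iic r) (LowerSet.Iic r) := by
  classical
  obtain ⟨R, hrR, hR⟩ := K.exists_forall_boundingRank_eq n r
  set B : Finset ℝ := (K.finite_criticalValues r).toFinset with hB
  set D : Finset ℝ := (K.finite_criticalValues R).toFinset.filter (r < ·) with hD
  have hBmem : ∀ x, x ∈ B ↔ x ∈ K.criticalValues ∧ x ≤ r := by simp [hB]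
  have hDmem : ∀ x, x ∈ D ↔ x ∈ K.criticalValues ∧ x ≤ R ∧ r < x := by simp [hD, and_assoc]
  -- Cycles present by r that ever bound do so by R, so no such class dies later. This leaves only
  -- finitely many deaths even if K is infinite.
  have hlate : ∀ b d : ℝ, b ≤ r → R < d → K.multiplicity n b d = 0 := fun b d hb hd => by
    refine Nat.cast_injective (R := ℤ) ?_
    have hb' : LowerSet.Iic b ≤ LowerSet.Iic r := LowerSet.Iic_le.2 hb
    have hb'' := (Iio_le_Iic b).trans hb'
    have hd' : LowerSet.Iic R ≤ LowerSet.Iio d := Iic_le_Iio hd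
    have hd'' := hd'.trans (Iio_le_Iic d)
    rw [multiplicity_coe (hb.trans_lt (hrR.trans_lt hd)), hR _ _ hb' hd', hR _ _ hb' hd'',
      hR _ _ hb'' hd', hR _ _ hb'' hd'']
    simp
  have hiff : ∀ x : K.Point n, r ∈ lifetime x.1 ↔
      x.1 ∈ B ×ˢ insert ⊤ (D.image ((↑) : ℝ → WithTop ℝ)) := by
    rintro ⟨⟨b, d⟩, i⟩
    have hm : K.multiplicity n b d ≠ 0 := (Fin.pos i).ne'
    simp only [lifetime, Set.mem_ofPred_eq, Finset.mem_product, Finset.mem_insert, hBmem,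
      birth_mem_criticalValues hm, true_and]
    refine and_congr_right fun hbr => ?_
    clear i
    induction d using WithTop.recTopCoe with
    | top => simp
    | coe d =>
      simp only [WithTop.coe_lt_coe, WithTop.coe_ne_top, false_or, Finset.mem_image,
        WithTop.coe_inj, exists_eq_right, hDmem, death_mem_criticalValues hm, true_and]
      refine ⟨fun h => ⟨?_, h⟩, fun h => h.2⟩
      by_contra hd
      exact hm (hlate b d hbr (not_le.1 hd))
  -- Deaths in (r, R] contribute the bounding rank at R minus that at r; the point at ∞ contributes
  -- cycles minus those that ever bound. The terms at R and ∞ cancel.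
  have hdeath : ∀ b ∈ B, ((∑ d ∈ insert ⊤ (D.image ((↑) : ℝ → WithTop ℝ)),
      K.multiplicity n b d : ℕ) : ℤ) =
      ((K.cycleRank n (LowerSet.Iic b) : ℤ)
        - K.boundingRank n (LowerSet.Iic b) (LowerSet.Iic r))
      - (K.cycleRank n (LowerSet.Iio b)
        - K.boundingRank n (LowerSet.Iio b) (LowerSet.Iic r)) := fun b hb => by
    have hbr := ((hBmem b).1 hb).2
    have hb' : LowerSet.Iic b ≤ LowerSet.Iic r := LowerSet.Iic_le.2 hbr
    rw [Finset.sum_insert (by simp), Finset.sum_image (by simp), Nat.cast_add, Nat.cast_sum,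
      Finset.sum_congr rfl fun d hd => multiplicity_coe (hbr.trans_lt ((hDmem d).1 hd).2.2),
      Finset.sum_sub_distrib]
    have hjump : ∀ U, ∑ d ∈ D, ((K.boundingRank n U (LowerSet.Iic d) : ℤ)
        - K.boundingRank n U (LowerSet.Iio d))
        = K.boundingRank n U (LowerSet.Iic R) - K.boundingRank n U (LowerSet.Iic r) := fun U =>
      sum_jumps (F := fun U' => (K.boundingRank n U U' : ℤ)) (C := K.criticalValues)
        (fun U₁ U₂ h hc => by rw [boundingRank, boundingRank, K.sub_eq_sub h hc])
        (LowerSet.Iic_le.2 hrR) fun x => by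
          rw [hDmem, LowerSet.mem_Iic_iff, LowerSet.mem_Iic_iff, not_le]
    rw [hjump, hjump, multiplicity_top, hR _ _ hb' le_rfl,
      hR _ _ ((Iio_le_Iic b).trans hb') le_rfl]
    ring
  rw [Nat.card_congr (Equiv.subtypeEquivRight hiff), card_point_mem, Finset.sum_product,
    Nat.cast_sum, Finset.sum_congr rfl hdeath,
    sum_jumps (F := fun U => (K.cycleRank n U : ℤ) - K.boundingRank n U (LowerSet.Iic r))
      (C := K.criticalValues)
      (fun U₁ U₂ h hc => by simp only [boundingRank, cycleRank]; rw [K.sub_eq_sub h hc])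
      (bot_le : ⊥ ≤ LowerSet.Iic r)
      fun x => by simp [hBmem]]
  have hbot : cycles (K.sub ⊥) n = ⊥ := by
    rw [cycles, chains_eq_bot fun s (hs : s ∈ K.sub ⊥) => absurd hs.2 LowerSet.notMem_bot,
      bot_inf_eq]
  have h1 : K.cycleRank n ⊥ = 0 := by rw [cycleRank, hbot, finrank_bot]
  have h2 : K.boundingRank n ⊥ (LowerSet.Iic r) = 0 := by
    rw [boundingRank, hbot, bot_inf_eq, finrank_bot]
  simp [h1, h2]

/-- The Euler characteristic at scale `r` is the alternating sum of the numbers of points of the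
persistence diagrams that are alive at `r`. -/
theorem eulerChar_atScale (K : FilteredComplex V) {D : Finset ℕ}
    (hD : ∀ n, Nonempty (K.Point n) → n ∈ D) (r : ℝ) :
    eulerChar (K.atScale r)
      = ∑ n ∈ D, (-1 : ℤ) ^ n * Nat.card {x : K.Point n // r ∈ lifetime x.1} := by
  rw [atScale, eulerChar_eq_finsum (finite_sub (K := K) (le_refl (LowerSet.Iic r)))]
  have h : ∀ n, ((Module.finrank (ZMod 2) (cycles (K.sub (LowerSet.Iic r)) n) : ℤ)
      - Module.finrank (ZMod 2) (boundaries (K.sub (LowerSet.Iic r)) n))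
      = Nat.card {x : K.Point n // r ∈ lifetime x.1} := fun n => by
    rw [card_lifetime, boundingRank, inf_eq_right.2 boundaries_le_cycles]
    rfl
  rw [finsum_congr fun n => congrArg ((-1 : ℤ) ^ n * ·) (h n)]
  refine finsum_eq_sum_of_support_subset _ fun n hn => hD n ?_
  by_contra hemp
  rw [not_nonempty_iff] at hemp
  exact hn (by simp)

end FilteredComplex

/-! ### Norms of differences of Betti curves -/

theorem measurableSet_lifetime (p : ℝ × WithTop ℝ) : MeasurableSet (lifetime p) := by
  obtain ⟨b, d⟩ := p
  induction d using WithTop.recTopCoe with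
  | top =>
    have : lifetime (b, ⊤) = Set.Ici b := by ext r; simp [lifetime]
    exact this ▸ measurableSet_Ici
  | coe d =>
    have : lifetime (b, (d : WithTop ℝ)) = Set.Ico b d := by ext r; simp [lifetime]
    exact this ▸ measurableSet_Ico

theorem lifetime_diagonal (x : ℝ) : lifetime (x, (x : WithTop ℝ)) = ∅ := by
  ext r
  simp [lifetime]

theorem volume_uIcc_eq_edist (a b : ℝ) : volume (Set.uIcc a b) = edist a b := by
  rw [Real.volume_interval, edist_comm, edist_dist, Real.dist_eq]

-- A scale in exactly one lifetime lies between the two births or between the two deaths; the 2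
-- comes from u + v ≤ 2 max(u, v).
open scoped symmDiff in
theorem volume_symmDiff_lifetime_le (x y : ℝ × WithTop ℝ) :
    volume (lifetime x ∆ lifetime y) ≤ 2 * distInf x y := by
  obtain ⟨b, d⟩ := x
  obtain ⟨b', d'⟩ := y
  have htwo : ∀ u v : ℝ≥0∞, u + v ≤ 2 * max u v := fun u v => by
    rw [two_mul]
    exact add_le_add (le_max_left _ _) (le_max_right _ _)
  refine le_trans ?_ (htwo _ _)
  dsimp only
  induction d using WithTop.recTopCoe with
  | top =>
    induction d' using WithTop.recTopCoe with
    | top =>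
      rw [← volume_uIcc_eq_edist]
      refine (measure_mono fun r hr => ?_).trans le_self_add
      simp only [lifetime, Set.mem_symmDiff, Set.mem_ofPred_eq, WithTop.coe_lt_top, and_true,
        not_le] at hr
      rw [Set.mem_uIcc]
      rcases hr with hr | hr
      · exact Or.inl ⟨hr.1, hr.2.le⟩
      · exact Or.inr ⟨hr.1, hr.2.le⟩
    -- Exactly one death is infinite, so the right side is ∞.
    | coe d' => simp [deathDist]
  | coe d =>
    induction d' using WithTop.recTopCoe with
    | top => simp [deathDist]
    | coe d' =>
      simp only [deathDist]
      rw [← volume_uIcc_eq_edist, ← volume_uIcc_eq_edist]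
      refine (measure_mono fun r hr => ?_).trans (measure_union_le _ _)
      simp only [lifetime, Set.mem_symmDiff, Set.mem_ofPred_eq, WithTop.coe_lt_coe, not_and,
        not_lt] at hr
      rw [Set.mem_union, Set.mem_uIcc, Set.mem_uIcc]
      rcases hr with ⟨⟨h1, h2⟩, h3⟩ | ⟨⟨h1, h2⟩, h3⟩
      -- If r is past the birth b', it misses the second lifetime only by being past d'; otherwise
      -- it lies between b and b'.
      · rcases le_or_gt b' r with h | h
        · exact Or.inr (Or.inr ⟨h3 h, h2.le⟩)
        · exact Or.inl (Or.inl ⟨h1, h.le⟩)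
      · rcases le_or_gt b r with h | h
        · exact Or.inr (Or.inl ⟨h3 h, h2.le⟩)
        · exact Or.inl (Or.inr ⟨h1, h.le⟩)

-- |1_A - 1_B| is the indicator of A ∆ B.
open scoped symmDiff in
theorem eLpNorm_indicator_one_sub {α : Type*} [MeasurableSpace α] {μ : Measure α} {A B : Set α}
    (hA : MeasurableSet A) (hB : MeasurableSet B) {q : ℝ≥0∞} (hq0 : q ≠ 0) (hq : q ≠ ⊤) :
    eLpNorm (A.indicator (fun _ => (1 : ℝ)) - B.indicator fun _ => (1 : ℝ)) q μ
      = μ (A ∆ B) ^ (1 / q.toReal) := by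
  have h := eLpNorm_indicator_const (μ := μ) (c := (1 : ℝ)) (hA.symmDiff hB) hq0 hq
  rw [enorm_one, one_mul] at h
  rw [← h]
  refine eLpNorm_congr_norm_ae (Filter.Eventually.of_forall fun r => ?_)
  by_cases h1 : r ∈ A <;> by_cases h2 : r ∈ B <;> simp [Set.mem_symmDiff, h1, h2]

theorem eLpNorm_indicator_lifetime_sub_le (x y : ℝ × WithTop ℝ) {q : ℝ≥0∞} (hq0 : q ≠ 0)
    (hq : q ≠ ⊤) :
    eLpNorm ((lifetime x).indicator (fun _ => (1 : ℝ))
        - (lifetime y).indicator fun _ => (1 : ℝ)) q volume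
      ≤ (2 * distInf x y) ^ (1 / q.toReal) := by
  rw [eLpNorm_indicator_one_sub (measurableSet_lifetime x) (measurableSet_lifetime y) hq0 hq]
  exact ENNReal.rpow_le_rpow (volume_symmDiff_lifetime_le x y) (by positivity)

/-! ### Betti curves, matchings and Minkowski's inequality. -/

namespace FilteredComplex

variable {V W : Type*}

/-- The number of points of the `n`-th persistence diagram that are alive at scale `r`, that is,
the `n`-th Betti number at scale `r`. -/
def bettiCurve (K : FilteredComplex V) (n : ℕ) (r : ℝ) : ℝ :=
  Nat.card {x : K.Point n // r ∈ lifetime x.1}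

theorem bettiCurve_eq_sum (K : FilteredComplex V) (n : ℕ) [Fintype (K.Point n)] :
    K.bettiCurve n = ∑ x : K.Point n, (lifetime x.1).indicator fun _ => (1 : ℝ) := by
  classical
  ext r
  rw [bettiCurve, Nat.card_eq_fintype_card, Fintype.card_subtype, Finset.sum_apply,
    Finset.card_filter, Nat.cast_sum]
  simp [Set.indicator_apply]

theorem measurable_bettiCurve (K : FilteredComplex V) (n : ℕ) [Finite (K.Point n)] :
    Measurable (K.bettiCurve n) := by
  have := Fintype.ofFinite (K.Point n)
  rw [bettiCurve_eq_sum, Finset.sum_fn]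
  exact Finset.measurable_sum _ fun (x : K.Point n) _ =>
    (measurable_const (a := (1 : ℝ))).indicator (measurableSet_lifetime x.1)

/-- Diagonal members of `F` contribute zero functions. -/
theorem sum_indicator_loc (K : FilteredComplex V) (n : ℕ) [Fintype (K.Point n)]
    {F : Finset (K.Diagram n)} (hF : ∀ x : K.Point n, (Sum.inl x : K.Diagram n) ∈ F) :
    ∑ x ∈ F, (lifetime x.loc).indicator (fun _ => (1 : ℝ)) = K.bettiCurve n := by
  classical
  rw [bettiCurve_eq_sum]
  refine (Finset.sum_of_injOn (Sum.inl : K.Point n → K.Diagram n)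
    (Sum.inl_injective.injOn) (fun x _ => hF x) ?_ fun x _ => rfl).symm
  rintro (x | x) - hx
  · exact absurd ⟨x, Finset.mem_coe.2 (Finset.mem_univ x), rfl⟩ hx
  · simp only [Diagram.loc, lifetime_diagonal, Set.indicator_empty]
    rfl

theorem eLpNorm_bettiCurve_sub_le (K : FilteredComplex V) (L : FilteredComplex W) (n : ℕ)
    [Finite (K.Point n)] [Finite (L.Point n)] (π : Matching K L n) {q : ℝ≥0∞} (hq1 : 1 ≤ q)
    (hq : q ≠ ⊤) :
    eLpNorm (K.bettiCurve n - L.bettiCurve n) q volume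
      ≤ ∑' x : K.Diagram n, (2 * distInf x.loc (π x).loc) ^ (1 / q.toReal) := by
  have := Fintype.ofFinite (K.Point n)
  have := Fintype.ofFinite (L.Point n)
  -- `F` holds every index whose pair has an off-diagonal end in either diagram. It is finite, and
  -- the remaining pairs contribute nothing.
  obtain ⟨F, hF⟩ : ∃ F : Finset (K.Diagram n), ∀ x : K.Diagram n, x ∈ F ↔
      x ∈ Set.range (Sum.inl : K.Point n → K.Diagram n)
        ∪ Set.range fun y : L.Point n => π.symm (Sum.inl y) :=
    ((Set.finite_range (Sum.inl : K.Point n → K.Diagram n)).union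
      (Set.finite_range fun y : L.Point n => π.symm (Sum.inl y))).exists_finset
  have hK : ∀ x : K.Point n, (Sum.inl x : K.Diagram n) ∈ F := fun x => (hF _).2 (Or.inl ⟨x, rfl⟩)
  have hL : ∀ y : L.Point n, (Sum.inl y : L.Diagram n) ∈ F.map π.toEmbedding := fun y =>
    Finset.mem_map_equiv.2 ((hF _).2 (Or.inr ⟨y, rfl⟩))
  have hsum : K.bettiCurve n - L.bettiCurve n
      = ∑ x ∈ F, ((lifetime x.loc).indicator (fun _ => (1 : ℝ))
        - (lifetime (π x).loc).indicator fun _ => (1 : ℝ)) := by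
    rw [Finset.sum_sub_distrib, sum_indicator_loc K n hK, ← sum_indicator_loc L n hL,
      Finset.sum_map]
    rfl
  rw [hsum]
  have hmeas : ∀ p : ℝ × WithTop ℝ, Measurable ((lifetime p).indicator fun _ => (1 : ℝ)) :=
    fun p => measurable_const.indicator (measurableSet_lifetime p)
  calc _ ≤ _ := eLpNorm_sum_le
        (fun x _ => ((hmeas x.loc).sub (hmeas (π x).loc)).aestronglyMeasurable) hq1
    _ ≤ ∑ x ∈ F, (2 * distInf x.loc (π x).loc) ^ (1 / q.toReal) :=
      Finset.sum_le_sum fun x _ =>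
        eLpNorm_indicator_lifetime_sub_le _ _ (zero_lt_one.trans_le hq1).ne' hq
    _ ≤ _ := ENNReal.sum_le_tsum F

/-- Minkowski over the finitely many dimensions carrying points; the signs (-1)^n have absolute
value one and disappear from the norms. -/
theorem eLpNorm_eulerChar_sub_le (K : FilteredComplex V) (L : FilteredComplex W)
    (hKdim : {n : ℕ | Nonempty (K.Point n)}.Finite)
    (hLdim : {n : ℕ | Nonempty (L.Point n)}.Finite)
    (hK : ∀ n : ℕ, Finite (K.Point n)) (hL : ∀ n : ℕ, Finite (L.Point n))
    {q : ℝ≥0∞} (hq : 1 ≤ q) :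
    eLpNorm (fun r : ℝ => (eulerChar (K.atScale r) : ℝ) - (eulerChar (L.atScale r) : ℝ)) q volume
      ≤ ∑' n : {n : ℕ // (n : ℕ∞) ≤ max (dim K.complex) (dim L.complex)},
        eLpNorm (K.bettiCurve n - L.bettiCurve n) q volume := by
  classical
  set D : Finset ℕ := hKdim.toFinset ∪ hLdim.toFinset with hD
  have hDK : ∀ n, Nonempty (K.Point n) → n ∈ D := fun n h =>
    Finset.mem_union_left _ (hKdim.mem_toFinset.2 h)
  have hDL : ∀ n, Nonempty (L.Point n) → n ∈ D := fun n h =>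
    Finset.mem_union_right _ (hLdim.mem_toFinset.2 h)
  have hDN : ∀ n ∈ D, (n : ℕ∞) ≤ max (dim K.complex) (dim L.complex) := fun n hn => by
    rcases Finset.mem_union.1 hn with h | h
    · exact (le_dim_of_nonempty_point (hKdim.mem_toFinset.1 h)).trans (le_max_left _ _)
    · exact (le_dim_of_nonempty_point (hLdim.mem_toFinset.1 h)).trans (le_max_right _ _)
  have hsum : (fun r : ℝ => (eulerChar (K.atScale r) : ℝ) - (eulerChar (L.atScale r) : ℝ))
      = ∑ n ∈ D, (-1 : ℝ) ^ n • (K.bettiCurve n - L.bettiCurve n) := by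
    ext r
    rw [eulerChar_atScale K hDK, eulerChar_atScale L hDL, Finset.sum_apply, Int.cast_sum,
      Int.cast_sum, ← Finset.sum_sub_distrib]
    refine Finset.sum_congr rfl fun n _ => ?_
    simp only [Pi.smul_apply, Pi.sub_apply, bettiCurve, smul_eq_mul]
    push_cast
    ring
  rw [hsum]
  calc _ ≤ _ := eLpNorm_sum_le (fun n _ => (((measurable_bettiCurve K n).sub
        (measurable_bettiCurve L n)).const_smul _).aestronglyMeasurable) hq
    _ = ∑ n ∈ D, eLpNorm (K.bettiCurve n - L.bettiCurve n) q volume := by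
      simp [eLpNorm_const_smul]
    _ = _ := (Finset.sum_subtype_of_mem
      (fun n => eLpNorm (K.bettiCurve n - L.bettiCurve n) q volume) hDN).symm
    _ ≤ _ := ENNReal.sum_le_tsum _

end FilteredComplex

end ECS

end

theorem mainTheorem1 {V W : Type*}
    (K : ℝ → ECS.FilteredComplex V) (L : ℝ → ECS.FilteredComplex W) (t : ℝ)
    (hKdim : {n : ℕ | Nonempty ((K t).Point n)}.Finite)
    (hLdim : {n : ℕ | Nonempty ((L t).Point n)}.Finite)
    (hK : ∀ n : ℕ, Finite ((K t).Point n)) (hL : ∀ n : ℕ, Finite ((L t).Point n))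
    (N : ℕ∞) (hN : N = max (ECS.dim (K t).complex) (ECS.dim (L t).complex)) :
    MeasureTheory.eLpNorm
        (fun r : ℝ => (ECS.eulerSurface K r t : ℝ) - (ECS.eulerSurface L r t : ℝ))
        1 MeasureTheory.volume
      ≤ 2 * ∑' n : {n : ℕ // (n : ℕ∞) ≤ N}, ECS.wasserstein 1 (K t) (L t) n ∧
    ∀ π : ∀ n : ℕ, ECS.Matching (K t) (L t) n,
      MeasureTheory.eLpNorm
          (fun r : ℝ => (ECS.eulerSurface K r t : ℝ) - (ECS.eulerSurface L r t : ℝ))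
          2 MeasureTheory.volume
        ≤ ∑' n : {n : ℕ // (n : ℕ∞) ≤ N}, ∑' x : (K t).Diagram n,
            (2 * ECS.distInf x.loc (π n x).loc) ^ (1 / 2 : ℝ) := by
  subst hN
  refine ⟨?_, fun π => ?_⟩
  · refine (ECS.FilteredComplex.eLpNorm_eulerChar_sub_le (K t) (L t) hKdim hLdim hK hL
      le_rfl).trans ?_
    rw [← ENNReal.tsum_mul_left]
    refine ENNReal.tsum_le_tsum fun n => ?_
    -- The factor 2 is nonzero and finite, so it passes inside the infimum and each matching can be
    -- treated separately.
    rw [ECS.wasserstein, ENNReal.mul_iInf_of_ne two_ne_zero ENNReal.ofNat_ne_top]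
    refine le_iInf fun π => ?_
    have h := ECS.FilteredComplex.eLpNorm_bettiCurve_sub_le (K t) (L t) n π
      (le_refl 1) ENNReal.one_ne_top
    simpa [ENNReal.tsum_mul_left] using h
  · refine (ECS.FilteredComplex.eLpNorm_eulerChar_sub_le (K t) (L t) hKdim hLdim hK hL
      one_le_two).trans (ENNReal.tsum_le_tsum fun n => ?_)
    simpa using ECS.FilteredComplex.eLpNorm_bettiCurve_sub_le (K t) (L t) n (π n)
      one_le_two ENNReal.ofNat_ne_top
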